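/- All rings are associative with $1$. For a finite ring $R$, let $G_R$ be its unitary Cayley graph: the simple graph with vertex set $R$ in which two distinct elements $a,b$ are adjacent if and only if $a-b$ is invertible in $R$. Let $R^{\mathrm{ss}} = R/\mathrm{Rad}(R)$ be the semisimplification of $R$, where $\mathrm{Rad}(R)$ is the Jacobson radical. A finite graph is perfect if, for each of its induced subgraphs $H$, the chromatic number of $H$ equals the size of a maximum clique of $H$. **Theorem.** Let $R$ be a finite ring whose semisimplification has a decomposition $$R^{\mathrm{ss}} \cong \prod_{i=1}^{s} R_i \times \prod_{j=1}^{r} M_{d_j}(F_j),$$ where $s, r \ge 0$, the $R_i$ are finite fields with $2 \le |R_1| \le |R_2| \le \dots \le |R_s|$, the $F_j$ are finite fields, and $d_j \ge 2$ for all $j$. Then $G_R$ is perfect if and only if at least one of the following conditions holds: 1. $s \ge 1$ and $|R_1| = 2$; 2. $r = 0$ and $s \le 2$; 3. $R^{\mathrm{ss}} \cong M_2(\mathbb{F}_2)$ as rings. Moreover, if condition 1 holds, then $G_R$ is bipartite. -/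

import Mathlib

namespace UnitaryCayley

/-- The unitary Cayley graph `G_R` of a ring `R`: the vertices are the elements of `R`, and two
distinct vertices `a`, `b` are adjacent iff `a - b` is invertible. (If `R` is nontrivial, then
`IsUnit (a - b)` already forces `a ≠ b`; the clause `a ≠ b` only discards the loop that the
zero ring would have.) -/
def unitaryCayleyGraph (R : Type*) [Ring R] : SimpleGraph R where
  Adj a b := a ≠ b ∧ IsUnit (a - b)
  symm := ⟨fun a b h => ⟨h.1.symm, by
    have h2 := h.2.neg
    rwa [neg_sub] at h2⟩⟩
  loopless := ⟨fun _ h => h.1 rfl⟩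

/-- A finite graph is perfect if the chromatic number of each of its induced subgraphs equals
the size of a maximum clique of that subgraph. -/
def IsPerfect {V : Type*} [Finite V] (G : SimpleGraph V) : Prop :=
  ∀ S : Set V, (G.induce S).chromaticNumber = ((G.induce S).cliqueNum : ℕ∞)

/-- The semisimplification `R^ss = R / Rad(R)`, where `Rad(R)` is the Jacobson radical. -/
abbrev Semisimplification (R : Type*) [Ring R] : Type _ := R ⧸ Ring.jacobson R

end UnitaryCayley

namespace UnitaryCayley

/-! Units of a finite ring are detected modulo the radical, so `G_R` is a blow-up of the graph of
`R^ss`, and perfectness lifts to it (`IsPerfect.comap`). Two fields give the grid points differing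
in both coordinates, and `M_2(𝔽_2)` gives a rook's graph; both are perfect by König's theorems on
vertex covers and on edge colourings. A factor `𝔽_2` makes the graph bipartite.

Otherwise there is an induced pentagon (`hasPentagon_prod`). A tuple is a unit iff all its
coordinates are, so it suffices to give each factor a closed 5-walk such that every chord fails in
some factor. Fields with more than two elements and matrix factors can spoil any two chords of
consecutive index, `M_2(𝔽_2)` also three chords, and every other matrix factor all five. -/

/-! ### Criteria for perfectness -/

theorem IsPerfect.of_exists_coloring_isNClique {V : Type*} [Finite V] {G : SimpleGraph V}
    (h : ∀ S : Set V, ∃ n, (G.induce S).Colorable n ∧ ∃ t, (G.induce S).IsNClique n t) :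
    IsPerfect G := by
  intro S
  obtain ⟨n, hc, t, ht⟩ := h S
  refine le_antisymm ?_ SimpleGraph.cliqueNum_le_chromaticNumber
  refine hc.chromaticNumber_le.trans ?_
  have := ht.isClique.card_le_cliqueNum (G := G.induce S)
  rw [ht.card_eq] at this
  exact_mod_cast this

/-- Perfectness only has to be checked by colouring each nonempty set of vertices with the same
number of colours as the size of a clique in it. -/
theorem IsPerfect.of_exists {V : Type*} [Finite V] {G : SimpleGraph V}
    (h : ∀ S : Set V, S.Nonempty → ∃ (C : Type*) (_ : Fintype C) (c : S → C) (q : C → S),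
      (∀ a b : S, G.Adj a b → c a ≠ c b) ∧ Pairwise fun i j => G.Adj (q i) (q j)) :
    IsPerfect G := by
  refine .of_exists_coloring_isNClique fun S => ?_
  rcases S.eq_empty_or_nonempty with rfl | hS
  · exact ⟨0, SimpleGraph.colorable_zero_iff.2 inferInstance, ∅, by simp⟩
  obtain ⟨C, _, c, q, hc, hadj⟩ := h S hS
  refine ⟨Fintype.card C, ?_, ?_⟩
  · exact SimpleGraph.Coloring.colorable (SimpleGraph.Coloring.mk c fun {a b} hab => hc a b hab)
  · have hinj : Function.Injective q := by
      intro i j hij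
      by_contra hne
      exact (hadj hne).ne (congrArg Subtype.val hij)
    refine ⟨Finset.univ.map ⟨_, hinj⟩, ?_, by simp⟩
    intro x hx y hy hxy
    simp only [Finset.coe_map, Set.mem_image, Finset.coe_univ, Set.mem_univ, true_and] at hx hy
    obtain ⟨i, rfl⟩ := hx
    obtain ⟨j, rfl⟩ := hy
    exact hadj fun hij => hxy (by rw [hij])

/-- `f` need not be injective: its fibres are independent sets, so colourings pull back along `f`
and cliques lift along a section over the image. -/
theorem IsPerfect.comap {V W : Type*} [Finite V] [Finite W] {G : SimpleGraph V}
    {H : SimpleGraph W} (hH : IsPerfect H) (f : V → W)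
    (hf : ∀ a b, G.Adj a b ↔ H.Adj (f a) (f b)) : IsPerfect G := by
  refine .of_exists_coloring_isNClique fun S => ?_
  have himg : ∀ y : (f '' S : Set W), ∃ x : S, f x = y := by
    rintro ⟨_, x, hx, rfl⟩
    exact ⟨⟨x, hx⟩, rfl⟩
  choose g hg using himg
  refine ⟨(H.induce (f '' S)).cliqueNum, ?_, ?_⟩
  · obtain ⟨C⟩ := SimpleGraph.chromaticNumber_le_iff_colorable.mp (hH (f '' S)).le
    exact ⟨SimpleGraph.Coloring.mk (fun x : S => C ⟨f x, Set.mem_image_of_mem f x.2⟩)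
      fun {a b} hab => C.valid (by simpa using (hf _ _).1 hab)⟩
  · obtain ⟨t, ht⟩ := (H.induce (f '' S)).exists_isNClique_cliqueNum
    have hinj : Function.Injective g := fun a b hab => Subtype.ext (by rw [← hg a, ← hg b, hab])
    refine ⟨t.map ⟨g, hinj⟩, ?_, by simpa using ht.card_eq⟩
    intro x hx y hy hxy
    simp only [Finset.coe_map, Set.mem_image, Finset.mem_coe] at hx hy
    obtain ⟨i, hi, rfl⟩ := hx
    obtain ⟨j, hj, rfl⟩ := hy
    have := ht.isClique hi hj fun hij => hxy (by rw [hij])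
    simpa [hf, hg] using this

theorem IsPerfect.of_isBipartite {V : Type*} [Finite V] {G : SimpleGraph V} (hG : G.IsBipartite) :
    IsPerfect G := by
  obtain ⟨C⟩ := hG
  refine .of_exists fun S ⟨v, hv⟩ => ?_
  by_cases hE : ∃ a b : S, G.Adj a b
  · obtain ⟨a, b, hab⟩ := hE
    refine ⟨Fin 2, inferInstance, fun x => C x, ![a, b], fun x y hxy => C.valid hxy, ?_⟩
    intro i j
    fin_cases i <;> fin_cases j <;> simp [hab, hab.symm]
  · push Not at hE
    exact ⟨Fin 1, inferInstance, fun _ => 0, fun _ => ⟨v, hv⟩,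
      fun x y hxy => (hE x y hxy).elim, fun i j hij => (hij (Subsingleton.elim _ _)).elim⟩

/-! ### König's theorems as perfectness of grid graphs -/

/-- Two points of the grid are adjacent iff they differ in both coordinates. -/
def generalPosition (α β : Type*) : SimpleGraph (α × β) where
  Adj a b := a.1 ≠ b.1 ∧ a.2 ≠ b.2
  symm := ⟨fun _ _ h => ⟨h.1.symm, h.2.symm⟩⟩
  loopless := ⟨fun _ h => h.1 rfl⟩

/-- The rook's graph: two points of the grid are adjacent iff they differ in exactly one
coordinate. -/
def rookGraph (α β : Type*) : SimpleGraph (α × β) where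
  Adj a b := (a.1 = b.1 ∧ a.2 ≠ b.2) ∨ (a.1 ≠ b.1 ∧ a.2 = b.2)
  symm := ⟨fun _ _ h => h.imp (fun h => ⟨h.1.symm, h.2.symm⟩) (fun h => ⟨h.1.symm, h.2.symm⟩)⟩
  loopless := ⟨fun _ h => h.elim (fun h => h.2 rfl) (fun h => h.1 rfl)⟩

/-- One side of a minimum vertex cover of a bipartite graph can be matched into the complement of
the other side. -/
theorem exists_injective_of_minimal_cover {α β : Type*} [Fintype β] (r : α → β → Prop)
    (A : Finset α) (B : Finset β) (hcov : ∀ a b, r a b → a ∈ A ∨ b ∈ B)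
    (hmin : ∀ (A' : Finset α) (B' : Finset β), (∀ a b, r a b → a ∈ A' ∨ b ∈ B') →
      A.card + B.card ≤ A'.card + B'.card) :
    ∃ g : A → β, Function.Injective g ∧ ∀ a : A, g a ∉ B ∧ r a (g a) := by
  classical
  have key := (Finset.all_card_le_biUnion_card_iff_exists_injective
    (fun a : A => Finset.univ.filter fun b => b ∉ B ∧ r a b)).1 ?_
  · simpa using key
  intro X
  set N := X.biUnion fun a : A => Finset.univ.filter fun b => b ∉ B ∧ r a b with hN
  -- Hall's condition: trading `X` for its neighbours `N` outside `B` again gives a cover, so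
  -- minimality yields `|X| ≤ |N|`.
  have h := hmin (A \ X.map ⟨_, Subtype.val_injective⟩) (B ∪ N) ?_
  · have h1 := Finset.card_union_le B N
    have hsub : X.map ⟨_, Subtype.val_injective⟩ ⊆ A := by
      intro a ha
      obtain ⟨x, _, rfl⟩ := Finset.mem_map.1 ha
      exact x.2
    have h2 := Finset.card_sdiff_add_card_eq_card hsub
    rw [Finset.card_map] at h2
    omega
  · intro a b hab
    by_cases hb : b ∈ B
    · exact .inr (Finset.mem_union_left _ hb)
    have ha : a ∈ A := (hcov a b hab).resolve_right hb
    by_cases hX : (⟨a, ha⟩ : A) ∈ X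
    · refine .inr (Finset.mem_union_right _ (Finset.mem_biUnion.2 ⟨_, hX, ?_⟩))
      simp [hb, hab]
    · exact .inl (by simp [ha, hX])

/-- König's theorem on matchings and vertex covers of bipartite graphs. -/
theorem isPerfect_generalPosition (α β : Type*) [Finite α] [Finite β] :
    IsPerfect (generalPosition α β) := by
  classical
  have := Fintype.ofFinite α
  have := Fintype.ofFinite β
  refine .of_exists fun S _ => ?_
  let cover : Set (Finset α × Finset β) := {P | ∀ a b, (a, b) ∈ S → a ∈ P.1 ∨ b ∈ P.2}
  obtain ⟨⟨A, B⟩, hcov, hmin⟩ := Set.exists_min_image cover (fun P => P.1.card + P.2.card)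
    (Set.toFinite _) ⟨(Finset.univ, Finset.univ), by simp [cover]⟩
  obtain ⟨g, hg, hgS⟩ := exists_injective_of_minimal_cover (fun a b => (a, b) ∈ S) A B hcov
    fun A' B' h => hmin (A', B') h
  obtain ⟨h, hh, hhS⟩ := exists_injective_of_minimal_cover (fun b a => (a, b) ∈ S) B A
    (fun b a hab => (hcov a b hab).symm)
    fun B' A' h => by simpa [add_comm] using hmin (A', B') fun a b hab => (h b a hab).symm
  -- A colour is a covering line through the point. The clique joins the two matchings; they share
  -- no line because `g` avoids `B` and `h` avoids `A`.
  refine ⟨A ⊕ B, inferInstance,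
    fun x => if hx : x.1.1 ∈ A then .inl ⟨_, hx⟩ else
      .inr ⟨x.1.2, (hcov _ _ x.2).resolve_left hx⟩,
    Sum.elim (fun a => ⟨(a, g a), (hgS a).2⟩) (fun b => ⟨(h b, b), (hhS b).2⟩), ?_, ?_⟩
  · rintro x y ⟨h1, h2⟩ hxy
    by_cases hx : x.1.1 ∈ A <;> by_cases hy : y.1.1 ∈ A <;> simp_all
  · rintro (i | i) (j | j) hij
    · have hij' : i ≠ j := fun h => hij (by rw [h])
      exact ⟨fun h => hij' (Subtype.ext h), fun h => hij' (hg h)⟩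
    · refine ⟨fun h' => (hhS j).1 ?_, fun h' => (hgS i).1 ?_⟩
      · exact (show i.1 = h j from h') ▸ i.2
      · exact (show g i = j.1 from h') ▸ j.2
    · refine ⟨fun h' => (hhS i).1 ?_, fun h' => (hgS j).1 ?_⟩
      · exact (show h i = j.1 from h') ▸ j.2
      · exact (show i.1 = g j from h') ▸ i.2
    · have hij' : i ≠ j := fun h => hij (by rw [h])
      exact ⟨fun h => hij' (hh h), fun h => hij' (Subtype.ext h)⟩

/-- The support of a square matrix of natural numbers with constant line sums `k` is covered by
`k` permutations. -/
theorem exists_injective_cover_of_sum_eq {m n : Type*} [Fintype m] [Fintype n]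
    (hcard : Fintype.card m = Fintype.card n) (k : ℕ) (M : m → n → ℕ)
    (hrow : ∀ i, ∑ j, M i j = k) (hcol : ∀ j, ∑ i, M i j = k) :
    ∃ f : Fin k → m → n, (∀ c, Function.Injective (f c)) ∧
      ∀ i j, M i j ≠ 0 → ∃ c, f c i = j := by
  classical
  induction k generalizing M with
  | zero =>
    refine ⟨fun c => c.elim0, fun c => c.elim0, fun i j hij => ?_⟩
    exact (hij (Finset.sum_eq_zero_iff.1 (hrow i) j (Finset.mem_univ j))).elim
  | succ k ih =>
    -- Hall's condition by double counting: the total weight `|X| (k + 1)` of the rows in `X` lies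
    -- in the columns `N`, whose total weight is `|N| (k + 1)`.
    obtain ⟨g, hg, hgM⟩ := (Finset.all_card_le_biUnion_card_iff_exists_injective
      (fun i : m => Finset.univ.filter fun j => M i j ≠ 0)).1 (by
        intro X
        set N := X.biUnion fun i : m => Finset.univ.filter fun j => M i j ≠ 0 with hN
        have h1 : ∑ i ∈ X, ∑ j, M i j = X.card * (k + 1) := by simp [hrow]
        have h2 : ∑ j ∈ N, ∑ i, M i j = N.card * (k + 1) := by simp [hcol]
        have h3 : ∑ i ∈ X, ∑ j, M i j = ∑ j ∈ N, ∑ i ∈ X, M i j := by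
          rw [Finset.sum_comm]
          symm
          refine Finset.sum_subset (Finset.subset_univ _) fun j _ hj => ?_
          refine Finset.sum_eq_zero fun i hi => ?_
          by_contra hne
          exact hj (Finset.mem_biUnion.2 ⟨i, hi, by simpa using hne⟩)
        have h4 : ∑ j ∈ N, ∑ i ∈ X, M i j ≤ ∑ j ∈ N, ∑ i, M i j :=
          Finset.sum_le_sum fun j _ => Finset.sum_le_sum_of_subset (Finset.subset_univ _)
        exact Nat.le_of_mul_le_mul_right (by omega : X.card * (k + 1) ≤ N.card * (k + 1))
          k.succ_pos)
    simp only [Finset.mem_filter, Finset.mem_univ, true_and] at hgM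
    have hbij := (Fintype.bijective_iff_injective_and_card g).2 ⟨hg, hcard⟩
    -- Truncated subtraction of the permutation matrix is exact, as `M i (g i)` is nonzero.
    have hsplit : ∀ i j, M i j = (M i j - if g i = j then 1 else 0) + if g i = j then 1 else 0 := by
      intro i j
      split_ifs with hij
      · have := hgM i
        rw [hij] at this
        omega
      · rfl
    obtain ⟨f, hf, hfM⟩ := ih (fun i j => M i j - if g i = j then 1 else 0)
      (fun i => by
        have := hrow i
        rw [Finset.sum_congr rfl fun j _ => hsplit i j, Finset.sum_add_distrib] at this
        simpa using this)
      (fun j => by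
        have := hcol j
        rw [Finset.sum_congr rfl fun i _ => hsplit i j, Finset.sum_add_distrib] at this
        obtain ⟨i, rfl⟩ := hbij.2 j
        simpa [hg.eq_iff] using this)
    refine ⟨Fin.cons g f, fun c => Fin.cases hg hf c, fun i j hij => ?_⟩
    by_cases hgij : g i = j
    · exact ⟨0, hgij⟩
    · obtain ⟨c, hc⟩ := hfM i j (by simpa [hgij] using hij)
      exact ⟨c.succ, hc⟩

/-- König's theorem on edge colourings of bipartite graphs. -/
theorem isPerfect_rookGraph (α β : Type*) [Finite α] [Finite β] :
    IsPerfect (rookGraph α β) := by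
  classical
  have := Fintype.ofFinite α
  have := Fintype.ofFinite β
  refine .of_exists fun S hS => ?_
  let ρ : α → ℕ := fun a => ∑ b, if (a, b) ∈ S then 1 else 0
  let κ : β → ℕ := fun b => ∑ a, if (a, b) ∈ S then 1 else 0
  have : Nonempty (α ⊕ β) := ⟨.inl hS.some.1⟩
  obtain ⟨x, hx⟩ := Finite.exists_max (Sum.elim ρ κ)
  set k := Sum.elim ρ κ x with hk
  have hρ : ∀ a, ρ a ≤ k := fun a => hx (.inl a)
  have hκ : ∀ b, κ b ≤ k := fun b => hx (.inr b)
  -- The incidence matrix of `S` and its transpose, padded by diagonal blocks of deficits, have all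
  -- line sums `k`. The colour of a cell is a permutation through it.
  obtain ⟨f, hf, hfS⟩ := exists_injective_cover_of_sum_eq (m := α ⊕ β) (n := β ⊕ α)
    (by simp [add_comm]) k
    (Sum.elim
      (fun a => Sum.elim (fun b => if (a, b) ∈ S then 1 else 0)
        (fun a' => if a = a' then k - ρ a else 0))
      (fun b => Sum.elim (fun b' => if b = b' then k - κ b else 0)
        (fun a => if (a, b) ∈ S then 1 else 0)))
    (by
      rintro (a | b)
      · have := hρ a
        simp only [Fintype.sum_sum_type, Sum.elim_inl, Sum.elim_inr, Finset.sum_ite_eq,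
          Finset.mem_univ, if_true]
        change ρ a + _ = k
        omega
      · have := hκ b
        simp only [Fintype.sum_sum_type, Sum.elim_inl, Sum.elim_inr, Finset.sum_ite_eq,
          Finset.mem_univ, if_true]
        change _ + κ b = k
        omega)
    (by
      rintro (b | a)
      · have := hκ b
        simp only [Fintype.sum_sum_type, Sum.elim_inl, Sum.elim_inr, Finset.sum_ite_eq',
          Finset.mem_univ, if_true]
        change κ b + _ = k
        omega
      · have := hρ a
        simp only [Fintype.sum_sum_type, Sum.elim_inl, Sum.elim_inr, Finset.sum_ite_eq',
          Finset.mem_univ, if_true]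
        change _ + ρ a = k
        omega)
  have hcol : ∀ p : S, ∃ c, f c (.inl p.1.1) = .inl p.1.2 := fun p => hfS _ _ (by simp)
  choose c hc using hcol
  have hproper : ∀ a b : S, (rookGraph α β).Adj a b → c a ≠ c b := by
    rintro a b (⟨h1, h2⟩ | ⟨h1, h2⟩) hab
    · have ha := hc a
      rw [hab, h1, hc b] at ha
      exact h2 (Sum.inl_injective ha).symm
    · have ha := hc a
      rw [hab, h2, ← hc b] at ha
      exact h1 (Sum.inl_injective (hf _ ha))
  rcases x with a | b
  -- A line with the most points of `S` is a clique of size `k`.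
  · have hka : k = Fintype.card {b // (a, b) ∈ S} := by
      rw [hk, Fintype.card_subtype, Finset.card_filter]; rfl
    let e := (Fintype.equivFinOfCardEq hka.symm).symm
    refine ⟨Fin k, inferInstance, c, fun i => ⟨(a, e i), (e i).2⟩, hproper, fun i j hij => ?_⟩
    exact .inl ⟨rfl, fun h => hij (e.injective (Subtype.ext h))⟩
  · have hkb : k = Fintype.card {a // (a, b) ∈ S} := by
      rw [hk, Fintype.card_subtype, Finset.card_filter]; rfl
    let e := (Fintype.equivFinOfCardEq hkb.symm).symm
    refine ⟨Fin k, inferInstance, c, fun i => ⟨(e i, b), (e i).2⟩, hproper, fun i j hij => ?_⟩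
    exact .inr ⟨fun h => hij (e.injective (Subtype.ext h)), rfl⟩

/-! ### Pentagons in fields and matrix rings -/

-- Take `w` to be multiplication by the root in `F[X]/(X^n - X + 1)`. The single relation `w (1 -
-- w^(n-1)) = 1` inverts `w`, and also `w - 1`, which divides `1 - w^(n-1)`. Irreducibility is not
-- needed.
open Polynomial in
theorem exists_isUnit_isUnit_sub_one {F : Type*} [Field F] {n : ℕ} (hn : 2 ≤ n) :
    ∃ w : Matrix (Fin n) (Fin n) F, IsUnit w ∧ IsUnit (w - 1) := by
  let p : F[X] := X ^ n + (1 - X)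
  have hdeg : (1 - X : F[X]).degree < n := by
    refine (degree_sub_le _ _).trans_lt ?_
    rw [degree_one, degree_X]
    exact max_lt (by exact_mod_cast (by omega : 0 < n)) (by exact_mod_cast (by omega : 1 < n))
  have hp : p.Monic := monic_X_pow_add hdeg
  have hpn : p.natDegree = n := by
    rw [natDegree_eq_of_degree_eq_some]
    rw [degree_add_eq_left_of_degree_lt (by simpa using hdeg), degree_X_pow]
  let b := (AdjoinRoot.powerBasis' hp).basis.reindex (finCongr hpn)
  have hroot : AdjoinRoot.root p ^ n + (1 - AdjoinRoot.root p) = 0 := by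
    have : AdjoinRoot.mk p (X ^ n + (1 - X)) = 0 := AdjoinRoot.mk_self
    rwa [map_add, map_sub, map_pow, AdjoinRoot.mk_X, map_one] at this
  obtain ⟨m, rfl⟩ : ∃ m, n = m + 1 := ⟨n - 1, by omega⟩
  refine ⟨Algebra.leftMulMatrix b (AdjoinRoot.root p), ?_, ?_⟩
  · refine IsUnit.map _ (IsUnit.of_mul_eq_one (1 - AdjoinRoot.root p ^ m) ?_)
    linear_combination -hroot
  · rw [← map_one (Algebra.leftMulMatrix b), ← map_sub]
    refine IsUnit.map _ (IsUnit.of_mul_eq_one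
      (-(AdjoinRoot.root p * ∑ i ∈ Finset.range m, AdjoinRoot.root p ^ i)) ?_)
    have := geom_sum_mul (AdjoinRoot.root p) m
    linear_combination (-AdjoinRoot.root p) * this - hroot

/-- A closed walk of length five in the graph of unit differences of `R` whose chords with index in
`D`, the chord `i` joining `p i` to `p (i + 2)`, are not unit differences. -/
def HasPentagon (R : Type*) [Ring R] (D : Set (Fin 5)) : Prop :=
  ∃ p : Fin 5 → R, (∀ i, IsUnit (p i - p (i + 1))) ∧ ∀ i ∈ D, ¬ IsUnit (p i - p (i + 2))

theorem HasPentagon.of_ringEquiv {R T : Type*} [Ring R] [Ring T] (e : R ≃+* T) {D : Set (Fin 5)}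
    (h : HasPentagon R D) : HasPentagon T D := by
  obtain ⟨p, h1, h2⟩ := h
  refine ⟨fun i => e (p i), fun i => ?_, fun i hi => ?_⟩ <;> rw [← map_sub, isUnit_map_iff]
  exacts [h1 i, h2 i hi]

theorem HasPentagon.pi {ι : Type*} {X : ι → Type*} [∀ k, Ring (X k)] {D : ι → Set (Fin 5)}
    (h : ∀ k, HasPentagon (X k) (D k)) : HasPentagon (∀ k, X k) (⋃ k, D k) := by
  choose p h1 h2 using h
  refine ⟨fun i k => p k i, fun i => Pi.isUnit_iff.2 fun k => h1 k i, fun i hi hu => ?_⟩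
  obtain ⟨k, hk⟩ := Set.mem_iUnion.1 hi
  exact h2 k i hk (Pi.isUnit_iff.1 hu k)

theorem HasPentagon.prod {A B : Type*} [Ring A] [Ring B] {D E : Set (Fin 5)}
    (hA : HasPentagon A D) (hB : HasPentagon B E) : HasPentagon (A × B) (D ∪ E) := by
  obtain ⟨p, h1, h2⟩ := hA
  obtain ⟨q, h3, h4⟩ := hB
  refine ⟨fun i => (p i, q i), fun i => Prod.isUnit_iff.2 ⟨h1 i, h3 i⟩, ?_⟩
  rintro i (hi | hi) hu
  · exact h2 i hi (Prod.isUnit_iff.1 hu).1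
  · exact h4 i hi (Prod.isUnit_iff.1 hu).2

theorem HasPentagon.fromBlocks {F : Type*} [Field F] {m n : ℕ} {D E : Set (Fin 5)}
    (hA : HasPentagon (Matrix (Fin m) (Fin m) F) D)
    (hB : HasPentagon (Matrix (Fin n) (Fin n) F) E) :
    HasPentagon (Matrix (Fin (m + n)) (Fin (m + n)) F) (D ∪ E) := by
  refine HasPentagon.of_ringEquiv (Matrix.reindexRingEquiv F finSumFinEquiv) ?_
  obtain ⟨p, h1, h2⟩ := hA
  obtain ⟨q, h3, h4⟩ := hB
  have hiff : ∀ i j, IsUnit (Matrix.fromBlocks (p i) 0 0 (q i) - Matrix.fromBlocks (p j) 0 0 (q j))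
      ↔ IsUnit (p i - p j) ∧ IsUnit (q i - q j) := by
    intro i j
    rw [sub_eq_add_neg, Matrix.fromBlocks_neg, Matrix.fromBlocks_add, neg_zero, neg_zero,
      add_zero, add_zero, ← sub_eq_add_neg, ← sub_eq_add_neg, Matrix.isUnit_fromBlocks_zero₂₁]
  refine ⟨fun i => Matrix.fromBlocks (p i) 0 0 (q i), fun i => (hiff _ _).2 ⟨h1 i, h3 i⟩, ?_⟩
  rintro i (hi | hi) hu
  · exact h2 i hi ((hiff _ _).1 hu).1
  · exact h4 i hi ((hiff _ _).1 hu).2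

theorem HasPentagon.mono {R : Type*} [Ring R] {D E : Set (Fin 5)} (h : HasPentagon R E)
    (hDE : D ⊆ E) : HasPentagon R D :=
  let ⟨p, h1, h2⟩ := h
  ⟨p, h1, fun i hi => h2 i (hDE hi)⟩

/-- A triangle of unit differences admits a closed walk of length five that returns to the same
vertex along two prescribed disjoint chords. -/
theorem hasPentagon_of_isUnit {R : Type*} [Ring R] [Nontrivial R] {w : R} (hw : IsUnit w)
    (hw1 : IsUnit (w - 1)) (a : Fin 5) : HasPentagon R {a, a + 1} := by
  have hw1' : IsUnit (1 - w) := by simpa using hw1.neg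
  -- Chords `0` and `1` of this walk have difference zero; shifting by `a` moves them to `a` and `a
  -- + 1`.
  let c : Fin 5 → R := ![0, 1, 0, 1, w]
  have hc : ∀ i, IsUnit (c i - c (i + 1)) := by
    intro i
    fin_cases i <;> simp [c, hw, hw1']
  refine ⟨fun i => c (i - a), fun i => ?_, ?_⟩
  · have := hc (i - a)
    rwa [sub_add_eq_add_sub] at this
  · rintro i (rfl | rfl)
    · simp [c]
    · have h1 : a + 1 - a = 1 := by revert a; decide
      have h2 : a + 1 + 2 - a = 3 := by revert a; decide
      simp [c, h1, h2]

/-- Filler for the second diagonal block, whose size may be `0` or `1`. No chord can be spoiled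
uniformly: for `n = 0` every element is a unit. -/
theorem hasPentagon_matrix_empty {F : Type*} [Field F] {t : F} (h0 : t ≠ 0) (h1 : t ≠ 1) (n : ℕ) :
    HasPentagon (Matrix (Fin n) (Fin n) F) ∅ := by
  have h := (hasPentagon_of_isUnit (isUnit_iff_ne_zero.2 h0)
    (isUnit_iff_ne_zero.2 (sub_ne_zero.2 h1)) 0).mono (Set.empty_subset _)
  obtain ⟨p, hp, -⟩ := h
  refine ⟨fun i => Matrix.scalar (Fin n) (p i), fun i => ?_, by simp⟩
  rw [← map_sub]
  exact (hp i).map _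

theorem hasPentagon_matrix_two {F : Type*} [Field F] {t : F} (h0 : t ≠ 0) (h1 : t ≠ 1) :
    HasPentagon (Matrix (Fin 2) (Fin 2) F) Set.univ := by
  -- The edge determinants are `1, t - 1, -1, -t, 1 - t`; every chord difference is singular.
  refine ⟨![0, !![1, 0; t, 1], !![1, 1; 1, 1], !![1, 0; 0, 0], !![1, 1; t, 1]], fun i => ?_,
    fun i _ => ?_⟩
  · rw [Matrix.isUnit_iff_isUnit_det, isUnit_iff_ne_zero, Matrix.det_fin_two]
    have h1' : t - 1 ≠ 0 := sub_ne_zero.2 h1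
    have h1'' : 1 - t ≠ 0 := sub_ne_zero.2 h1.symm
    fin_cases i <;> simp [h0, h1', h1'']
  · rw [Matrix.isUnit_iff_isUnit_det, isUnit_iff_ne_zero, Matrix.det_fin_two, not_not]
    fin_cases i <;> simp

/-- Spoiling all five chords is impossible here, the graph being perfect. These three are the ones
that the pair `{0, 1}` leaves over. -/
theorem hasPentagon_matrix_two_zmod :
    HasPentagon (Matrix (Fin 2) (Fin 2) (ZMod 2)) {2, 3, 4} := by
  refine ⟨![0, 1, !![0, 1; 0, 0], !![1, 1; 1, 1], !![0, 1; 1, 0]], fun i => ?_, ?_⟩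
  · rw [Matrix.isUnit_iff_isUnit_det, isUnit_iff_ne_zero, Matrix.det_fin_two]
    revert i
    decide
  · simp only [Matrix.isUnit_iff_isUnit_det, isUnit_iff_ne_zero, Matrix.det_fin_two, not_not]
    rintro i (rfl | rfl | rfl) <;> decide

/-- The block construction fails for `3 = 2 + 1`, since `𝔽_2` has no closed walk of odd length;
hence an explicit witness. -/
theorem hasPentagon_matrix_three_zmod :
    HasPentagon (Matrix (Fin 3) (Fin 3) (ZMod 2)) Set.univ := by
  refine ⟨![0, 1, !![0, 0, 0; 0, 0, 0; 0, 1, 0], !![1, 0, 0; 1, 0, 1; 0, 0, 0],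
    !![0, 0, 1; 1, 0, 0; 0, 1, 0]], fun i => ?_, fun i _ => ?_⟩
  · rw [Matrix.isUnit_iff_isUnit_det, isUnit_iff_ne_zero, Matrix.det_fin_three]
    revert i
    decide
  · rw [Matrix.isUnit_iff_isUnit_det, isUnit_iff_ne_zero, Matrix.det_fin_three, not_not]
    revert i
    decide

theorem exists_ne_zero_ne_one {F : Type*} [Field F] (hF : Nat.card F ≠ 2) :
    ∃ t : F, t ≠ 0 ∧ t ≠ 1 := by
  by_contra! h
  refine hF (Nat.card_eq_two_iff.2 ⟨0, 1, zero_ne_one, ?_⟩)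
  ext t
  by_cases ht : t = 0 <;> simp [ht, h]

theorem nonempty_ringEquiv_zmod_two {F : Type*} [Field F] (hF : Nat.card F = 2) :
    Nonempty (F ≃+* ZMod 2) := by
  have : Finite F := Nat.finite_of_card_ne_zero (by omega)
  have := Fintype.ofFinite F
  rw [Nat.card_eq_fintype_card] at hF
  exact ⟨(ZMod.ringEquivOfPrime F Nat.prime_two hF).symm⟩

theorem hasPentagon_matrix_pair {F : Type*} [Field F] {n : ℕ} (hn : 2 ≤ n) (a : Fin 5) :
    HasPentagon (Matrix (Fin n) (Fin n) F) {a, a + 1} := by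
  have : Nonempty (Fin n) := ⟨⟨0, by omega⟩⟩
  obtain ⟨w, hw, hw1⟩ := exists_isUnit_isUnit_sub_one (F := F) hn
  exact hasPentagon_of_isUnit hw hw1 a

theorem pair_union_eq_univ : ({0, 0 + 1} ∪ {2, 3, 4} : Set (Fin 5)) = Set.univ := by
  ext i
  fin_cases i <;> simp

theorem nonempty_matrix_ringEquiv_zmod_two {F : Type*} [Field F] (hF : Nat.card F = 2) {n : ℕ}
    (hn : n = 2) :
    Nonempty (Matrix (Fin n) (Fin n) F ≃+* Matrix (Fin 2) (Fin 2) (ZMod 2)) := by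
  subst hn
  obtain ⟨e⟩ := nonempty_ringEquiv_zmod_two hF
  exact ⟨e.mapMatrix⟩

theorem hasPentagon_matrix_two_of_card {F : Type*} [Field F] (hF : Nat.card F = 2) {n : ℕ}
    (hn : n = 2) : HasPentagon (Matrix (Fin n) (Fin n) F) {2, 3, 4} :=
  let ⟨e⟩ := nonempty_matrix_ringEquiv_zmod_two hF hn
  hasPentagon_matrix_two_zmod.of_ringEquiv e.symm

/-- `M_n(F)`, `n ≥ 2`, contains an induced pentagon unless it is `M_2(𝔽_2)`. -/
theorem hasPentagon_matrix {F : Type*} [Field F] {n : ℕ} (hn : 2 ≤ n)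
    (h : ¬ (n = 2 ∧ Nat.card F = 2)) : HasPentagon (Matrix (Fin n) (Fin n) F) Set.univ := by
  obtain ⟨m, rfl⟩ := Nat.exists_eq_add_of_le hn
  by_cases hF : Nat.card F = 2
  · rcases (by omega : m = 1 ∨ 2 ≤ m) with rfl | hm
    · obtain ⟨e⟩ := nonempty_ringEquiv_zmod_two hF
      exact hasPentagon_matrix_three_zmod.of_ringEquiv e.symm.mapMatrix
    · rw [← pair_union_eq_univ, Set.union_comm]
      exact (hasPentagon_matrix_two_of_card hF rfl).fromBlocks (hasPentagon_matrix_pair hm 0)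
  · obtain ⟨t, h0, h1⟩ := exists_ne_zero_ne_one hF
    simpa using (hasPentagon_matrix_two h0 h1).fromBlocks (hasPentagon_matrix_empty h0 h1 m)

theorem HasPentagon.of_surjective {R T : Type*} [Ring R] [Ring T] (φ : R →+* T)
    (hφ : Function.Surjective φ) [IsLocalHom φ] {D : Set (Fin 5)} (h : HasPentagon T D) :
    HasPentagon R D := by
  obtain ⟨p, h1, h2⟩ := h
  choose g hg using hφ
  refine ⟨fun i => g (p i), fun i => ?_, fun i hi => ?_⟩ <;>
    rw [← isUnit_map_iff φ, map_sub, hg, hg]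
  exacts [h1 i, h2 i hi]

/-- An induced pentagon has no triangle but, being an odd cycle, is not 2-colourable. Adjacency is
read off the indices, so injectivity of `p` is not needed. -/
theorem HasPentagon.not_isPerfect {R : Type*} [Ring R] [Finite R]
    (h : HasPentagon R Set.univ) : ¬ IsPerfect (unitaryCayleyGraph R) := by
  obtain ⟨p, h1, h2⟩ := h
  intro hperf
  have hR : Nontrivial R := by
    by_contra hR
    rw [not_nontrivial_iff_subsingleton] at hR
    exact h2 0 trivial (isUnit_of_subsingleton _)
  have hadj : ∀ i, (unitaryCayleyGraph R).Adj (p i) (p (i + 1)) :=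
    fun i => ⟨fun h => not_isUnit_zero (M₀ := R) (by simpa [h] using h1 i), h1 i⟩
  have hnadj : ∀ i, ¬ (unitaryCayleyGraph R).Adj (p i) (p (i + 2)) := fun i h => h2 i trivial h.2
  have hcases : ∀ i j : Fin 5, i = j ∨ j = i + 1 ∨ i = j + 1 ∨ j = i + 2 ∨ i = j + 2 := by decide
  have hnext : ∀ i j, (unitaryCayleyGraph R).Adj (p i) (p j) → j = i + 1 ∨ i = j + 1 := by
    intro i j hij
    rcases hcases i j with rfl | h | h | rfl | rfl
    · exact (hij.ne rfl).elim
    · exact .inl h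
    · exact .inr h
    · exact (hnadj _ hij).elim
    · exact (hnadj _ hij.symm).elim
  obtain ⟨t, ht⟩ := ((unitaryCayleyGraph R).induce (Set.range p)).exists_isNClique_cliqueNum
  have hclique : ((unitaryCayleyGraph R).induce (Set.range p)).cliqueNum ≤ 2 := by
    by_contra! hlt
    rw [← ht.card_eq, Finset.two_lt_card] at hlt
    obtain ⟨⟨_, i, rfl⟩, hi, ⟨_, j, rfl⟩, hj, ⟨_, k, rfl⟩, hk, hij, hik, hjk⟩ := hlt
    have nij := hnext i j (ht.isClique hi hj hij)
    have nik := hnext i k (ht.isClique hi hk hik)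
    have njk := hnext j k (ht.isClique hj hk hjk)
    clear hi hj hk hij hik hjk
    revert i j k
    decide
  obtain ⟨C⟩ := (SimpleGraph.chromaticNumber_le_iff_colorable.mp (hperf (Set.range p)).le).mono
    hclique
  have hC : ∀ i, C ⟨p i, i, rfl⟩ ≠ C ⟨p (i + 1), i + 1, rfl⟩ := fun i => C.valid (hadj i)
  have h0 := hC 0
  have h1 := hC 1
  have h2 := hC 2
  have h3 := hC 3
  have h4 := hC 4
  simp only [show (0 : Fin 5) + 1 = 1 from rfl, show (1 : Fin 5) + 1 = 2 from rfl,
    show (2 : Fin 5) + 1 = 3 from rfl, show (3 : Fin 5) + 1 = 4 from rfl,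
    show (4 : Fin 5) + 1 = 0 from rfl] at h0 h1 h2 h3 h4
  omega

/-! ### Reduction modulo the radical and the perfect cases -/

/-- A left inverse lifts modulo the radical to a left inverse in `R`, which is two-sided because `R`
is finite. -/
instance isLocalHom_mk_jacobson (R : Type*) [Ring R] [Finite R] :
    IsLocalHom (Ideal.Quotient.mk (Ring.jacobson R)) where
  map_nonunit a ha := by
    obtain ⟨b', hb'⟩ := ha.exists_left_inv
    obtain ⟨b, rfl⟩ := Ideal.Quotient.mk_surjective b'
    rw [← map_mul, ← map_one (Ideal.Quotient.mk _), Ideal.Quotient.eq, ← Ideal.jacobson_bot] at hb'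
    obtain ⟨c, hc⟩ := Ideal.exists_mul_sub_mem_of_sub_one_mem_jacobson _ hb'
    rw [Ideal.mem_bot, sub_eq_zero, ← mul_assoc] at hc
    exact .of_mul_eq_one_right _ hc

theorem unitaryCayleyGraph_adj_iff {R T : Type*} [Ring R] [Ring T] [Nontrivial T] (φ : R →+* T)
    [IsLocalHom φ] (a b : R) : (unitaryCayleyGraph R).Adj a b ↔ IsUnit (φ a - φ b) := by
  rw [← map_sub, isUnit_map_iff]
  refine ⟨fun h => h.2, fun h => ⟨?_, h⟩⟩
  rintro rfl
  exact not_isUnit_zero (M₀ := T) (by simpa using h.map φ)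

/-- Coordinates identifying the unitary Cayley graph of `M_2(𝔽_2)` with the `4 × 4` rook's graph:
the units and zero form the union of two complementary planes. -/
def rookCoordinates (M : Matrix (Fin 2) (Fin 2) (ZMod 2)) : (ZMod 2 × ZMod 2) × (ZMod 2 × ZMod 2) :=
  ((M 0 1 + M 1 0, M 0 0 + M 0 1 + M 1 1), (M 0 0 + M 1 1, M 0 0 + M 0 1 + M 1 0))

theorem isUnit_sub_iff_rookGraph_adj (M N : Matrix (Fin 2) (Fin 2) (ZMod 2)) :
    IsUnit (M - N) ↔ (rookGraph _ _).Adj (rookCoordinates M) (rookCoordinates N) := by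
  rw [Matrix.isUnit_iff_isUnit_det, isUnit_iff_ne_zero, Matrix.det_fin_two]
  simp only [rookGraph, rookCoordinates, Prod.mk.injEq, Matrix.sub_apply, ne_eq]
  generalize M 0 0 = a, M 0 1 = b, M 1 0 = c, M 1 1 = d, N 0 0 = a', N 0 1 = b', N 1 0 = c',
    N 1 1 = d'
  revert a b c d a' b' c' d'
  decide

theorem isPerfect_of_matrix_two {R : Type*} [Ring R] [Finite R]
    (φ : R →+* Matrix (Fin 2) (Fin 2) (ZMod 2)) [IsLocalHom φ] :
    IsPerfect (unitaryCayleyGraph R) :=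
  (isPerfect_rookGraph _ _).comap (fun a => rookCoordinates (φ a)) fun a b =>
    (unitaryCayleyGraph_adj_iff φ a b).trans (isUnit_sub_iff_rookGraph_adj _ _)

theorem isPerfect_of_pi {R : Type*} [Ring R] [Finite R] {s : ℕ} (hs : s ≤ 2) {K : Fin s → Type*}
    [∀ i, Field (K i)] [∀ i, Finite (K i)] (φ : R →+* ∀ i, K i) [IsLocalHom φ] :
    IsPerfect (unitaryCayleyGraph R) := by
  have hunit : ∀ a b, IsUnit (φ a - φ b) ↔ ∀ i, φ a i ≠ φ b i := by
    intro a b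
    simp [Pi.isUnit_iff, sub_eq_zero]
  rcases (by omega : s = 0 ∨ s = 1 ∨ s = 2) with rfl | rfl | rfl
  · have h0 : IsUnit (0 : R) := by
      rw [← isUnit_map_iff φ]
      exact isUnit_of_subsingleton _
    have := isUnit_zero_iff.1 h0
    have : Subsingleton R := subsingleton_of_zero_eq_one this
    exact (isPerfect_generalPosition Unit Unit).comap (fun _ => ((), ()))
      fun a b => by simp [generalPosition, Subsingleton.elim a b]
  -- Doubling the coordinate places the single field on the diagonal of a grid.
  · refine (isPerfect_generalPosition (K 0) (K 0)).comap (fun a => (φ a 0, φ a 0)) fun a b => ?_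
    rw [unitaryCayleyGraph_adj_iff φ, hunit]
    simp [generalPosition]
  · refine (isPerfect_generalPosition (K 0) (K 1)).comap (fun a => (φ a 0, φ a 1)) fun a b => ?_
    rw [unitaryCayleyGraph_adj_iff φ, hunit, Fin.forall_fin_two]
    rfl

theorem isBipartite_of_card_eq_two {R F : Type*} [Ring R] [Field F] (hF : Nat.card F = 2)
    (φ : R →+* F) : (unitaryCayleyGraph R).IsBipartite := by
  obtain ⟨e⟩ := nonempty_ringEquiv_zmod_two hF
  refine ⟨SimpleGraph.Coloring.mk (fun a => e (φ a)) fun {a b} hab h => ?_⟩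
  have := (hab.2.map φ).ne_zero
  exact this (by rw [map_sub, e.injective h, sub_self])

/-! ### Assembling a pentagon from the factors -/

theorem hasPentagon_prod {s r : ℕ} (K : Fin s → Type*) [∀ i, Field (K i)] [∀ i, Finite (K i)]
    (hK : Monotone fun i => Nat.card (K i)) (F : Fin r → Type*) [∀ j, Field (F j)]
    (d : Fin r → ℕ) (hd : ∀ j, 2 ≤ d j) (h1 : ∀ h : 0 < s, Nat.card (K ⟨0, h⟩) ≠ 2)
    (h2 : r = 0 → 2 < s)
    (h3 : IsEmpty (((∀ i, K i) × (∀ j, Matrix (Fin (d j)) (Fin (d j)) (F j))) ≃+*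
      Matrix (Fin 2) (Fin 2) (ZMod 2))) :
    HasPentagon ((∀ i, K i) × (∀ j, Matrix (Fin (d j)) (Fin (d j)) (F j))) Set.univ := by
  have hKp : ∀ i a, HasPentagon (K i) {a, a + 1} := by
    intro i a
    have hs : 0 < s := i.pos
    have hlt : 1 < Nat.card (K ⟨0, hs⟩) := Finite.one_lt_card
    have hle : Nat.card (K ⟨0, hs⟩) ≤ Nat.card (K i) := hK (Fin.mk_le_of_le_val (Nat.zero_le _))
    have hne := h1 hs
    obtain ⟨t, ht0, ht1⟩ := exists_ne_zero_ne_one (F := K i) (by omega)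
    exact hasPentagon_of_isUnit (isUnit_iff_ne_zero.2 ht0)
      (isUnit_iff_ne_zero.2 (sub_ne_zero.2 ht1)) a
  have hMp : ∀ j a, HasPentagon (Matrix (Fin (d j)) (Fin (d j)) (F j)) {a, a + 1} :=
    fun j a => hasPentagon_matrix_pair (hd j) a
  have key : ∀ (D : Fin s → Set (Fin 5)) (E : Fin r → Set (Fin 5)),
      (∀ i, HasPentagon (K i) (D i)) →
      (∀ j, HasPentagon (Matrix (Fin (d j)) (Fin (d j)) (F j)) (E j)) →
      (∀ c, (∃ i, c ∈ D i) ∨ ∃ j, c ∈ E j) →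
      HasPentagon ((∀ i, K i) × (∀ j, Matrix (Fin (d j)) (Fin (d j)) (F j))) Set.univ :=
    fun D E hD hE hDE => ((HasPentagon.pi hD).prod (HasPentagon.pi hE)).mono fun c _ => by
      simpa using hDE c
  by_cases hbig : ∃ j, ¬ (d j = 2 ∧ Nat.card (F j) = 2)
  · obtain ⟨j₀, hj₀⟩ := hbig
    refine key (fun _ => {0, 0 + 1}) (fun j => if j = j₀ then Set.univ else {0, 0 + 1})
      (fun i => hKp i 0) (fun j => ?_) fun c => .inr ⟨j₀, by simp⟩
    split_ifs with hj
    · exact hj ▸ hasPentagon_matrix (hd j₀) hj₀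
    · exact hMp j 0
  push Not at hbig
  rcases Nat.eq_zero_or_pos r with hr | hr
  · have hs := h2 hr
    -- The first three fields spoil `{0, 1}`, `{2, 3}` and `{4, 0}`.
    refine key (fun i => {Fin.ofNat 5 (2 * i), Fin.ofNat 5 (2 * i) + 1})
      (fun _ => {0, 0 + 1}) (fun i => hKp i _) (fun j => hMp j 0) fun c => .inl ?_
    fin_cases c
    exacts [⟨⟨0, by omega⟩, .inl rfl⟩, ⟨⟨0, by omega⟩, .inr rfl⟩, ⟨⟨1, by omega⟩, .inl rfl⟩,
      ⟨⟨1, by omega⟩, .inr rfl⟩, ⟨⟨2, by omega⟩, .inl rfl⟩]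
  -- All matrix factors are now `M_2(𝔽_2)`. One spoils `{2, 3, 4}`, any further factor `{0, 1}`; a
  -- lone factor is excluded by `h3`.
  refine key (fun _ => {0, 0 + 1}) (fun j => if j.1 = 0 then {2, 3, 4} else {0, 0 + 1})
    (fun i => hKp i 0) (fun j => ?_) fun c => ?_
  · split_ifs with hj
    · exact hasPentagon_matrix_two_of_card (hbig j).2 (hbig j).1
    · exact hMp j 0
  · have hc : c ∈ ({0, 0 + 1} ∪ {2, 3, 4} : Set (Fin 5)) := pair_union_eq_univ ▸ trivial
    rcases hc with hc | hc
    · rcases Nat.eq_zero_or_pos s with rfl | hs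
      · rcases (by omega : r = 1 ∨ 1 < r) with rfl | hr1
        · obtain ⟨e⟩ := nonempty_matrix_ringEquiv_zmod_two (hbig 0).2 (hbig 0).1
          exact (h3.false ((RingEquiv.zeroRingProd _ _).symm.trans
            ((RingEquiv.piUnique _).trans e))).elim
        · exact .inr ⟨⟨1, hr1⟩, by simpa using hc⟩
      · exact .inl ⟨⟨0, hs⟩, hc⟩
    · exact .inr ⟨⟨0, hr⟩, by simpa using hc⟩

end UnitaryCayley

open UnitaryCayley

theorem mainTheorem1
    (R : Type*) [Ring R] [Finite R]
    (s r : ℕ)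
    (K : Fin s → Type*) [∀ i, Field (K i)] [∀ i, Finite (K i)]
    (hK : Monotone fun i => Nat.card (K i))
    (F : Fin r → Type*) [∀ j, Field (F j)] [∀ j, Finite (F j)]
    (d : Fin r → ℕ) (hd : ∀ j, 2 ≤ d j)
    (e : UnitaryCayley.Semisimplification R ≃+*
      ((∀ i, K i) × (∀ j, Matrix (Fin (d j)) (Fin (d j)) (F j)))) :
    (UnitaryCayley.IsPerfect (UnitaryCayley.unitaryCayleyGraph R) ↔
      ((∃ h : 0 < s, Nat.card (K ⟨0, h⟩) = 2) ∨
        (r = 0 ∧ s ≤ 2) ∨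
        Nonempty (UnitaryCayley.Semisimplification R ≃+*
          Matrix (Fin 2) (Fin 2) (ZMod 2)))) ∧
    ((∃ h : 0 < s, Nat.card (K ⟨0, h⟩) = 2) →
      (UnitaryCayley.unitaryCayleyGraph R).IsBipartite) := by
  let π := Ideal.Quotient.mk (Ring.jacobson R)
  have hbip : (∃ h : 0 < s, Nat.card (K ⟨0, h⟩) = 2) →
      (unitaryCayleyGraph R).IsBipartite := fun ⟨_, h⟩ =>
    isBipartite_of_card_eq_two h
      ((Pi.evalRingHom K _).comp ((RingHom.fst _ _).comp (e.toRingHom.comp π)))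
  refine ⟨⟨fun hperf => ?_, ?_⟩, hbip⟩
  · by_contra! h
    obtain ⟨h1, h2, h3⟩ := h
    have hp := hasPentagon_prod K hK F d hd h1 h2 ⟨fun f => h3.false (e.trans f)⟩
    exact ((hp.of_ringEquiv e.symm).of_surjective π
      Ideal.Quotient.mk_surjective).not_isPerfect hperf
  · rintro (h | ⟨rfl, hs⟩ | ⟨⟨f⟩⟩)
    · exact .of_isBipartite (hbip h)
    · let f := e.trans (RingEquiv.prodZeroRing (∀ i, K i) _).symm
      exact isPerfect_of_pi hs ((RingHomClass.toRingHom f).comp π)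
    · exact isPerfect_of_matrix_two ((RingHomClass.toRingHom f).comp π)
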